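/- Let $k\ge 2$, let $S\in\mathbb{C}[x]$ have only simple roots and degree coprime with $k$, and let $\mathcal{C}=\{(x,y)\in\mathbb{C}^2 : y^k=S(x)\}$. Let $\xi,\zeta\in\mathbb{C}$ be primitive $k$-th roots of unity (for instance $\zeta=\xi$ or $\zeta=\xi^{-1}$) and let $\sigma:\mathcal{C}\to\mathcal{C}$, $\sigma(x,y)=(x,\zeta y)$, be the corresponding shift of the branches. The ramification points are the points of $\mathcal{C}$ with $y=0$. A divisor on $\mathcal{C}$ is a finitely supported function $\mathcal{C}\to\mathbb{Z}$. It is principal if it is of the form $z\mapsto \operatorname{ord}_z f$ for a nonzero rational function $f$ on $\mathcal{C}$, and of torsion if $N$ times it is principal for some integer $N\ge 1$. A superelliptic divisor is a finitely supported function $D:\mathcal{C}\to\mathbb{Z}[\xi]$ with $D(\sigma(z))=\xi D(z)$ for all $z$. It is principal if $D=\sum_{i=1}^{l}a_iD_i$ with $a_i\in\mathbb{Z}[\xi]$ and principal divisors $D_i$, and of torsion if $ND$ is principal for some nonzero $N\in\mathbb{Z}[\xi]$. Proposition. For every superelliptic divisor $D$ there is a unique divisor $\tilde D:\mathcal{C}\to\mathbb{Z}$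 such that $$kD(z)=\sum_{i=0}^{k-1}\xi^{-i}\tilde D(\sigma^i(z))\quad\text{for all } z\in\mathcal{C},$$ $$\sum_{i=0}^{k-1}\tilde D(\sigma^i(z))\,\xi^{ij}=0\quad\text{for all } z\in\mathcal{C}\text{ and all } j\in\mathbb{N}\text{ with }\gcd(j,k)\ne 1,$$ and $\tilde D(z)=0$ at every ramification point $z$. Moreover, $D$ is of torsion if and only if $\tilde D$ is of torsion. -/

import Mathlib

open Polynomial

noncomputable section

namespace Superelliptic

/-- The (affine) superelliptic curve `y ^ k = S(x)`: its complex points. -/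
abbrev Point (k : ℕ) (S : ℂ[X]) : Type := {p : ℂ × ℂ // p.2 ^ k = S.eval p.1}

/-- The coordinate ring `ℂ[x, y] / (y ^ k - S(x))`; the inner variable is `x`, the outer one `y`. -/
abbrev CoordinateRing (k : ℕ) (S : ℂ[X]) : Type := AdjoinRoot (X ^ k - C S : ℂ[X][X])

/-- The ring of rational functions on the curve. If `k ≥ 1` and `S` has a simple root, then the
coordinate ring is a domain, this is a field, and its units are the nonzero rational functions. -/
abbrev FunctionField (k : ℕ) (S : ℂ[X]) : Type := FractionRing (CoordinateRing k S)

variable {k : ℕ} {S : ℂ[X]}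

/-- Evaluation of regular functions at a point of the curve. -/
def evalAt (z : Point k S) : CoordinateRing k S →+* ℂ :=
  AdjoinRoot.lift (evalRingHom z.1.1) z.1.2 (by simp [z.2])

/-- The prime ideal of the regular functions that vanish at a point. -/
abbrev idealAt (z : Point k S) : Ideal (CoordinateRing k S) := RingHom.ker (evalAt z)

instance (z : Point k S) : (idealAt z).IsPrime := RingHom.ker_isPrime (evalAt z)

/-- The order of vanishing of a regular function at a point, i.e. the length of the quotient of
the local ring at this point by the function. -/
def ordAt (z : Point k S) (g : CoordinateRing k S) : ℕ∞ :=
  Ring.ord (Localization.AtPrime (idealAt z))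
    (algebraMap (CoordinateRing k S) (Localization.AtPrime (idealAt z)) g)

/-- The rational function `f` has order `n` at `z`: it is a quotient `g / h` of regular functions
with `n = ord_z g - ord_z h`, both orders being finite. -/
def HasOrderAt (f : FunctionField k S) (z : Point k S) (n : ℤ) : Prop :=
  ∃ g ∈ nonZeroDivisors (CoordinateRing k S), ∃ h ∈ nonZeroDivisors (CoordinateRing k S),
    f * algebraMap (CoordinateRing k S) (FunctionField k S) h =
      algebraMap (CoordinateRing k S) (FunctionField k S) g ∧
    ∃ a b : ℕ, ordAt z g = a ∧ ordAt z h = b ∧ n = (a : ℤ) - (b : ℤ)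

/-- Divisors on the curve: integer valued functions with finite support. -/
abbrev Divisor (k : ℕ) (S : ℂ[X]) : Type := Point k S →₀ ℤ

/-- `D` is the divisor of a nonzero rational function. -/
def Divisor.IsPrincipal (D : Divisor k S) : Prop :=
  ∃ f : (FunctionField k S)ˣ, ∀ z : Point k S, HasOrderAt (f : FunctionField k S) z (D z)

/-- Some positive multiple of `D` is principal. -/
def Divisor.IsTorsion (D : Divisor k S) : Prop :=
  ∃ N : ℕ, 0 < N ∧ Divisor.IsPrincipal (N • D)

/-- The ring `ℤ[ξ]`, as a subring of `ℂ`. -/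
abbrev RootRing (ξ : ℂ) : Type := Algebra.adjoin ℤ ({ξ} : Set ℂ)

/-- The shift `(x, y) ↦ (x, ζ y)` of the branches, `ζ` a primitive `k`-th root of unity. -/
def shift {ζ : ℂ} (hζ : IsPrimitiveRoot ζ k) (z : Point k S) : Point k S :=
  ⟨(z.1.1, ζ * z.1.2), by rw [mul_pow, hζ.pow_eq_one, one_mul]; exact z.2⟩

/-- The ramification points of the projection `(x, y) ↦ x`. -/
def IsRamificationPoint (z : Point k S) : Prop := z.1.2 = 0

/-- The finitely supported functions from the curve to `ℤ[ξ]`. -/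
abbrev RootDivisor (k : ℕ) (S : ℂ[X]) (ξ : ℂ) : Type := Point k S →₀ RootRing ξ

variable {ξ : ℂ}

/-- `D` is a superelliptic divisor: `D (σ z) = ξ D z`. -/
def IsSuperelliptic (σ : Point k S → Point k S) (D : RootDivisor k S ξ) : Prop :=
  ∀ z : Point k S, (D (σ z) : ℂ) = ξ * (D z : ℂ)

/-- `D` is a `ℤ[ξ]`-linear combination of principal divisors. -/
def RootDivisor.IsPrincipal (D : RootDivisor k S ξ) : Prop :=
  ∃ (l : ℕ) (a : Fin l → RootRing ξ) (E : Fin l → Divisor k S),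
    (∀ i, Divisor.IsPrincipal (E i)) ∧ ∀ z : Point k S, D z = ∑ i, a i * ((E i z : ℤ) : RootRing ξ)

/-- Some multiple of `D` by a nonzero element of `ℤ[ξ]` is principal. -/
def RootDivisor.IsTorsion (D : RootDivisor k S ξ) : Prop :=
  ∃ N : RootRing ξ, N ≠ 0 ∧ RootDivisor.IsPrincipal (N • D)

/-- The divisor `E` represents the superelliptic divisor `D`. -/
structure Represents (σ : Point k S → Point k S) (D : RootDivisor k S ξ) (E : Divisor k S) :
    Prop where
  sum_eq : ∀ z : Point k S,
    (k : ℂ) * (D z : ℂ) = ∑ i ∈ Finset.range k, ξ ^ (-(i : ℤ)) * (E (σ^[i] z) : ℂ)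
  sum_eq_zero : ∀ j : ℕ, ¬ Nat.Coprime j k → ∀ z : Point k S,
    ∑ i ∈ Finset.range k, (E (σ^[i] z) : ℂ) * ξ ^ (i * j) = 0
  eq_zero_of_ramification : ∀ z : Point k S, IsRamificationPoint z → E z = 0

end Superelliptic

end

/-! The divisor is $\tilde D = \operatorname{Tr}\circ D$, with $\operatorname{Tr}$ the trace of
$\mathbb{Q}(\xi)/\mathbb{Q}$, which is integral on $\mathbb{Z}[\xi]$. Since $D(\sigma^i z)=\xi^i
D(z)$, both sum conditions concern the Fourier transform of $i\mapsto\operatorname{Tr}(\xi^i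
x)=\sum_\varphi\varphi(\xi)^i\varphi(x)$. Its frequencies $\varphi(\xi)$ are primitive $k$-th roots
of unity, and the inclusion alone has $\varphi(\xi)=\xi$ (`exists_trace_fourier`).

Uniqueness is Galois conjugation: a Fourier coefficient of an integer sequence that vanishes at one
primitive root vanishes at all of them, because the cyclotomic polynomial is irreducible
(`eq_zero_of_fourier_eq_zero`).

For torsion, the trace is additive, so it turns a $\mathbb{Z}[\xi]$-combination of principal
divisors into an integral one. Conversely, the formula for $kD$ is a $\mathbb{Z}[\xi]$-combination
of shifts of $\tilde D$, and shifts preserve principality. -/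

noncomputable section

/-- The order of vanishing is invariant under ring isomorphisms. -/
theorem Ring.ord_ringEquiv {R R' : Type*} [CommRing R] [CommRing R'] (e : R ≃+* R') (a : R) :
    Ring.ord R' (e a) = Ring.ord R a := by
  have h : e.symm.idealComapOrderIso (Ideal.span {a}) = Ideal.span {e a} := by
    change Ideal.comap e.symm (Ideal.span {a}) = _
    rw [← Ideal.map_symm, Ideal.map_span, Set.image_singleton]
    rfl
  rw [Ring.ord, Ring.ord, Module.length_quotient, Module.length_quotient, ← h,
    Order.coheight_orderIso]

/-- A ring isomorphism preserves the order of vanishing in the local rings at corresponding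
primes. -/
theorem Ring.ord_localization_ringEquiv {R R' : Type*} [CommRing R] [CommRing R'] (e : R ≃+* R')
    (I : Ideal R) (J : Ideal R') [I.IsPrime] [J.IsPrime] (h : ∀ x, e x ∈ J ↔ x ∈ I) (a : R) :
    Ring.ord (Localization.AtPrime J) (algebraMap R' _ (e a)) =
      Ring.ord (Localization.AtPrime I) (algebraMap R _ a) := by
  have H : I.primeCompl.map e.toMonoidHom = J.primeCompl := by
    ext y
    constructor
    · rintro ⟨x, hx, rfl⟩
      exact fun hy => hx ((h x).1 hy)
    · intro hy
      refine ⟨e.symm y, fun hx => hy ?_, e.apply_symm_apply y⟩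
      simpa using (h _).2 hx
  rw [← IsLocalization.ringEquivOfRingEquiv_eq (S := Localization.AtPrime I)
    (Q := Localization.AtPrime J) H a, Ring.ord_ringEquiv]

/-! ### Principal divisors and their invariance under the shift -/

namespace Superelliptic

variable {k : ℕ} {S : ℂ[X]}

theorem ordAt_one (z : Point k S) : ordAt z 1 = 0 := by
  rw [ordAt, map_one, Ring.ord_one]

theorem ordAt_mul (z : Point k S) (g : CoordinateRing k S) {h : CoordinateRing k S}
    (hh : h ∈ nonZeroDivisors (CoordinateRing k S)) :
    ordAt z (g * h) = ordAt z g + ordAt z h := by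
  rw [ordAt, map_mul, Ring.ord_mul]
  · rfl
  -- Additivity needs `h` to be a non-zero-divisor in the local ring, and localization preserves
  -- this.
  · exact IsLocalization.map_nonZeroDivisors_le (idealAt z).primeCompl _
      (Submonoid.mem_map_of_mem _ hh)

theorem HasOrderAt.one (z : Point k S) : HasOrderAt (1 : FunctionField k S) z 0 :=
  ⟨1, one_mem _, 1, one_mem _, by simp, 0, 0, ordAt_one z, ordAt_one z, by simp⟩

theorem HasOrderAt.mul {f f' : FunctionField k S} {z : Point k S} {n n' : ℤ}
    (H : HasOrderAt f z n) (H' : HasOrderAt f' z n') : HasOrderAt (f * f') z (n + n') := by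
  obtain ⟨g, hg, h, hh, e, a, b, ha, hb, rfl⟩ := H
  obtain ⟨g', hg', h', hh', e', a', b', ha', hb', rfl⟩ := H'
  refine ⟨g * g', mul_mem hg hg', h * h', mul_mem hh hh', ?_, a + a', b + b', ?_, ?_, ?_⟩
  · rw [map_mul, map_mul, ← e, ← e', mul_mul_mul_comm]
  · rw [ordAt_mul z g hg', ha, ha', Nat.cast_add]
  · rw [ordAt_mul z h hh', hb, hb', Nat.cast_add]
  · push_cast; ring

theorem HasOrderAt.inv {f : (FunctionField k S)ˣ} {z : Point k S} {n : ℤ}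
    (H : HasOrderAt (f : FunctionField k S) z n) :
    HasOrderAt ((f⁻¹ : (FunctionField k S)ˣ) : FunctionField k S) z (-n) := by
  obtain ⟨g, hg, h, hh, e, a, b, ha, hb, rfl⟩ := H
  exact ⟨h, hh, g, hg, by rw [← e, Units.inv_mul_cancel_left], b, a, hb, ha, by ring⟩

/-- The principal divisors form a group. -/
def principalDivisors (k : ℕ) (S : ℂ[X]) : AddSubgroup (Divisor k S) where
  carrier := {D | Divisor.IsPrincipal D}
  zero_mem' := ⟨1, fun z => HasOrderAt.one z⟩
  add_mem' := by
    rintro D D' ⟨f, hf⟩ ⟨f', hf'⟩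
    exact ⟨f * f', fun z => (hf z).mul (hf' z)⟩
  neg_mem' := by
    rintro D ⟨f, hf⟩
    exact ⟨f⁻¹, fun z => (hf z).inv⟩

/-- The endomorphism `y ↦ c y` of the coordinate ring, for `c ^ k = 1`. -/
def scaleHom (c : ℂ) (hc : c ^ k = 1) : CoordinateRing k S →+* CoordinateRing k S :=
  AdjoinRoot.lift (AdjoinRoot.of _) (AdjoinRoot.of _ (C c) * AdjoinRoot.root _) (by
    have h := AdjoinRoot.eval₂_root (X ^ k - C S : ℂ[X][X])
    simp only [eval₂_sub, eval₂_X_pow, eval₂_C] at h ⊢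
    rw [mul_pow, ← map_pow, ← C_pow, hc, C_1, map_one, one_mul, h])

theorem scaleHom_comp (c d : ℂ) (hc : c ^ k = 1) (hd : d ^ k = 1) (hcd : c * d = 1) :
    (scaleHom c hc).comp (scaleHom d hd) = RingHom.id (CoordinateRing k S) := by
  refine AdjoinRoot.ringHom_ext ?_ ?_
  · ext <;> simp [scaleHom]
  · simp only [scaleHom, RingHom.comp_apply, AdjoinRoot.lift_root, map_mul, AdjoinRoot.lift_of,
      RingHom.id_apply]
    rw [← mul_assoc, ← map_mul, ← C_mul, mul_comm d c, hcd, C_1, map_one, one_mul]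

/-- The automorphism `y ↦ ζ y` of the coordinate ring. -/
def shiftEquiv {ζ : ℂ} (hk : k ≠ 0) (hζ : IsPrimitiveRoot ζ k) :
    CoordinateRing k S ≃+* CoordinateRing k S :=
  RingEquiv.ofRingHom (scaleHom ζ hζ.pow_eq_one)
    (scaleHom ζ⁻¹ (by rw [inv_pow, hζ.pow_eq_one, inv_one]))
    (scaleHom_comp _ _ _ _ (mul_inv_cancel₀ (hζ.ne_zero hk)))
    (scaleHom_comp _ _ _ _ (inv_mul_cancel₀ (hζ.ne_zero hk)))

variable {ζ : ℂ} (hζ : IsPrimitiveRoot ζ k)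

theorem evalAt_shiftEquiv (hk : k ≠ 0) (z : Point k S) (g : CoordinateRing k S) :
    evalAt z (shiftEquiv hk hζ g) = evalAt (shift hζ z) g := by
  have h : (evalAt z).comp (scaleHom ζ hζ.pow_eq_one) = evalAt (shift hζ z) := by
    refine AdjoinRoot.ringHom_ext ?_ ?_
    · ext <;> simp [scaleHom, evalAt, shift]
    · simp [scaleHom, evalAt, shift]
  exact congrArg (fun φ : CoordinateRing k S →+* ℂ => φ g) h

theorem ordAt_shiftEquiv (hk : k ≠ 0) (z : Point k S) (g : CoordinateRing k S) :
    ordAt z (shiftEquiv hk hζ g) = ordAt (shift hζ z) g :=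
  Ring.ord_localization_ringEquiv _ _ _
    (fun x => by rw [RingHom.mem_ker, RingHom.mem_ker, evalAt_shiftEquiv]) g

theorem HasOrderAt.comp_shift (hk : k ≠ 0) {f : FunctionField k S} {z : Point k S} {n : ℤ}
    (H : HasOrderAt f (shift hζ z) n) :
    HasOrderAt (IsFractionRing.ringEquivOfRingEquiv (L := FunctionField k S)
      (shiftEquiv (S := S) hk hζ) f) z n := by
  obtain ⟨g, hg, h, hh, e, a, b, ha, hb, rfl⟩ := H
  have hmem : ∀ x ∈ nonZeroDivisors (CoordinateRing k S),
      shiftEquiv hk hζ x ∈ nonZeroDivisors (CoordinateRing k S) := fun x hx => by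
    rw [← MulEquivClass.map_nonZeroDivisors (shiftEquiv hk hζ)]
    exact Submonoid.mem_map_of_mem _ hx
  refine ⟨_, hmem g hg, _, hmem h hh, ?_, a, b, ?_, ?_, rfl⟩
  · rw [← IsFractionRing.ringEquivOfRingEquiv_algebraMap (K := FunctionField k S),
      ← IsFractionRing.ringEquivOfRingEquiv_algebraMap (K := FunctionField k S), ← map_mul, e]
  · rw [ordAt_shiftEquiv, ha]
  · rw [ordAt_shiftEquiv, hb]

theorem shift_injective (hk : k ≠ 0) : Function.Injective (shift (S := S) hζ) := by
  intro z w h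
  have h' := congrArg Subtype.val h
  simp only [shift, Prod.mk.injEq] at h'
  exact Subtype.ext (Prod.ext h'.1 (mul_left_cancel₀ (hζ.ne_zero hk) h'.2))

/-- The pullback of a divisor under an iterate of the shift. -/
def pullback (hk : k ≠ 0) (i : ℕ) (E : Divisor k S) : Divisor k S :=
  E.comapDomain (shift hζ)^[i] ((shift_injective hζ hk).iterate i).injOn

/-- The shift comes from the automorphism $y\mapsto\zeta y$, which identifies the local rings at
$\sigma(z)$ and $z$; composing a rational function with it pulls back its divisor. -/
theorem isPrincipal_pullback (hk : k ≠ 0) (i : ℕ) {E : Divisor k S} (hE : E.IsPrincipal) :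
    (pullback hζ hk i E).IsPrincipal := by
  induction i with
  | zero => exact hE
  | succ i ih =>
    obtain ⟨f, hf⟩ := ih
    refine ⟨Units.map (IsFractionRing.ringEquivOfRingEquiv (K := FunctionField k S)
      (L := FunctionField k S) (shiftEquiv (S := S) hk hζ) : FunctionField k S →* FunctionField k S) f,
      fun z => HasOrderAt.comp_shift hζ hk ?_⟩
    -- By definition $\sigma^{i+1}(z)=\sigma^i(\sigma(z))$, so the two values of the pullbacks
    -- agree.
    exact hf (shift hζ z)

end Superelliptic
end


/-! ### The trace, its Fourier transform and uniqueness -/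

noncomputable section
namespace Superelliptic

variable {k : ℕ} {S : ℂ[X]} {ξ : ℂ}

/-- The generator `ξ` of `ℤ[ξ]`. -/
def rootGen (ξ : ℂ) : RootRing ξ := ⟨ξ, Algebra.self_mem_adjoin_singleton ℤ ξ⟩

theorem isIntegral_rootRing (hk : k ≠ 0) (hξ : IsPrimitiveRoot ξ k) (x : RootRing ξ) :
    IsIntegral ℤ (x : ℂ) :=
  adjoin_le_integralClosure (hξ.isIntegral (Nat.pos_of_ne_zero hk)) x.2

theorem sum_pow_of_pow_eq_one {w : ℂ} (hw : w ^ k = 1) :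
    ∑ i ∈ Finset.range k, w ^ i = if w = 1 then (k : ℂ) else 0 := by
  split_ifs with h
  · simp [h]
  · rw [geom_sum_eq h, hw, sub_self, zero_div]

/-- The inclusion of `ℤ[ξ]` into `ℚ(ξ)`. -/
def toField (ξ : ℂ) : RootRing ξ →+* IntermediateField.adjoin ℚ ({ξ} : Set ℂ) :=
  (algebraMap (RootRing ξ) ℂ).codRestrict
    (IntermediateField.adjoin ℚ ({ξ} : Set ℂ)) fun x =>
      (Algebra.adjoin_le (S := (IntermediateField.adjoin ℚ ({ξ} : Set ℂ)).toSubalgebra.restrictScalars ℤ)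
        (IntermediateField.subset_adjoin ℚ {ξ})) x.2

/-- The trace of `ℚ(ξ)` restricted to `ℤ[ξ]`, as the sum over the embeddings of `ℚ(ξ)`. -/
theorem exists_trace (hk : k ≠ 0) (hξ : IsPrimitiveRoot ξ k) :
    ∃ (_ : Fintype (IntermediateField.adjoin ℚ ({ξ} : Set ℂ) →ₐ[ℚ] ℂ)) (T : RootRing ξ →+ ℤ),
      ∀ x, (T x : ℂ) = ∑ φ : IntermediateField.adjoin ℚ ({ξ} : Set ℂ) →ₐ[ℚ] ℂ,
        φ (toField ξ x) := by
  have hint : IsIntegral ℚ ξ := (hξ.isIntegral (Nat.pos_of_ne_zero hk)).tower_top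
  have := IntermediateField.adjoin.finiteDimensional hint
  have key : ∀ x : RootRing ξ, ∃ n : ℤ, (n : ℂ) =
      ∑ φ : IntermediateField.adjoin ℚ ({ξ} : Set ℂ) →ₐ[ℚ] ℂ, φ (toField ξ x) := fun x => by
    have hx : IsIntegral ℤ (toField ξ x) :=
      (isIntegral_algHom_iff
        ((IntermediateField.adjoin ℚ ({ξ} : Set ℂ)).val.restrictScalars ℤ)
        Subtype.val_injective).1 (isIntegral_rootRing hk hξ x)
    -- The trace of an algebraic integer is rational and integral, hence an integer.
    obtain ⟨n, hn⟩ := IsIntegrallyClosed.isIntegral_iff.1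
      (Algebra.isIntegral_trace (L := ℚ) hx)
    refine ⟨n, ?_⟩
    rw [← trace_eq_sum_embeddings, ← hn]
    simp
  choose T hT using key
  refine ⟨inferInstance, AddMonoidHom.mk' T fun x y => ?_, hT⟩
  have : ((T (x + y) : ℤ) : ℂ) = ((T x + T y : ℤ) : ℂ) := by
    rw [hT, Int.cast_add, hT, hT, ← Finset.sum_add_distrib]
    simp only [map_add]
  exact_mod_cast this

/-- The discrete Fourier transform of `i ↦ Tr (ξ ^ i x)`. -/
theorem exists_trace_fourier (hk : k ≠ 0) (hξ : IsPrimitiveRoot ξ k) :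
    ∃ T : RootRing ξ →+ ℤ, ∀ x : RootRing ξ,
      ((k : ℂ) * x = ∑ i ∈ Finset.range k, ξ ^ (-(i : ℤ)) * (T (rootGen ξ ^ i * x) : ℂ)) ∧
      ∀ j : ℕ, ¬ j.Coprime k →
        ∑ i ∈ Finset.range k, (T (rootGen ξ ^ i * x) : ℂ) * ξ ^ (i * j) = 0 := by
  obtain ⟨_, T, hT⟩ := exists_trace hk hξ
  refine ⟨T, fun x => ?_⟩
  have hroot : ∀ φ : IntermediateField.adjoin ℚ ({ξ} : Set ℂ) →ₐ[ℚ] ℂ,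
      IsPrimitiveRoot (φ (toField ξ (rootGen ξ))) k := fun φ => by
    refine IsPrimitiveRoot.map_of_injective (f := φ) ?_ φ.injective
    exact IsPrimitiveRoot.of_map_of_injective (f := IntermediateField.val _) hξ
      Subtype.val_injective
  -- Exchanging the sums leaves, for each embedding, a geometric series in the $k$-th root of unity
  -- $\varphi(\xi)c$.
  have key : ∀ c : ℂ, c ^ k = 1 →
      ∑ i ∈ Finset.range k, (T (rootGen ξ ^ i * x) : ℂ) * c ^ i =
      ∑ φ : IntermediateField.adjoin ℚ ({ξ} : Set ℂ) →ₐ[ℚ] ℂ,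
        φ (toField ξ x) * if φ (toField ξ (rootGen ξ)) * c = 1 then (k : ℂ) else 0 := by
    intro c hc
    simp only [hT, Finset.sum_mul]
    rw [Finset.sum_comm]
    refine Finset.sum_congr rfl fun φ _ => ?_
    rw [← sum_pow_of_pow_eq_one (by rw [mul_pow, (hroot φ).pow_eq_one, hc, one_mul]),
      Finset.mul_sum]
    refine Finset.sum_congr rfl fun i _ => ?_
    simp only [map_mul, map_pow, mul_pow]
    ring
  constructor
  · have h := key ξ⁻¹ (by rw [inv_pow, hξ.pow_eq_one, inv_one])
    let v : IntermediateField.adjoin ℚ ({ξ} : Set ℂ) →ₐ[ℚ] ℂ := IntermediateField.val _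
    have hv : ∀ y, v (toField ξ y) = y := fun _ => rfl
    have hsingle := h.trans (Finset.sum_eq_single v (fun φ _ hφ => ?_)
      fun hv => absurd (Finset.mem_univ v) hv)
    · rw [hv, hv, show (rootGen ξ : ℂ) = ξ from rfl,
        if_pos (mul_inv_cancel₀ (hξ.ne_zero hk))] at hsingle
      rw [mul_comm]
      refine hsingle.symm.trans (Finset.sum_congr rfl fun i _ => ?_)
      rw [mul_comm, inv_pow, zpow_neg, zpow_natCast]
    · rw [if_neg, mul_zero]
      intro he
      apply hφ
      -- An embedding fixing the generator $\xi$ is the inclusion, so only `v` contributes.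
      refine IntermediateField.adjoin_algHom_ext ℚ fun y hy => ?_
      obtain rfl : y = ξ := hy
      exact eq_of_mul_inv_eq_one he
  · intro j hj
    have h := key (ξ ^ j) (by rw [← pow_mul, mul_comm, pow_mul, hξ.pow_eq_one, one_pow])
    simp only [← pow_mul, mul_comm j] at h
    refine h.trans (Finset.sum_eq_zero fun φ _ => ?_)
    rw [if_neg, mul_zero]
    intro he
    apply hj
    have : IsPrimitiveRoot (ξ ^ j) k := by
      rw [eq_inv_of_mul_eq_one_right he]
      exact (hroot φ).inv
    exact (hξ.pow_iff_coprime (Nat.pos_of_ne_zero hk) j).1 this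

/-- An integer sequence of length `k` whose Fourier coefficients vanish at all exponents that are
not coprime to `k` and at one that is vanishes. -/
theorem eq_zero_of_fourier_eq_zero (hk : k ≠ 0) (hξ : IsPrimitiveRoot ξ k) (f : ℕ → ℤ)
    (h₁ : ∑ i ∈ Finset.range k, ξ ^ (-(i : ℤ)) * (f i : ℂ) = 0)
    (h₂ : ∀ j : ℕ, ¬ j.Coprime k → ∑ i ∈ Finset.range k, (f i : ℂ) * ξ ^ (i * j) = 0) :
    ∀ i < k, f i = 0 := by
  set P : ℤ[X] := ∑ i ∈ Finset.range k, C (f i) * X ^ i with hP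
  have heval : ∀ w : ℂ, aeval w P = ∑ i ∈ Finset.range k, (f i : ℂ) * w ^ i := fun w => by
    simp [hP]
  have hk' := Nat.pos_of_ne_zero hk
  have hdvd : cyclotomic k ℤ ∣ P := by
    rw [cyclotomic_eq_minpoly hξ.inv hk']
    refine minpoly.isIntegrallyClosed_dvd (hξ.inv.isIntegral hk') ?_
    rw [heval, ← h₁]
    refine Finset.sum_congr rfl fun i _ => ?_
    rw [mul_comm, inv_pow, zpow_neg, zpow_natCast]
  -- Divisibility by the cyclotomic polynomial handles coprime exponents, `h₂` the others; `P` then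
  -- has $k$ roots but degree below $k$.
  have hzero : ∀ j : ℕ, aeval (ξ ^ j) P = 0 := fun j => by
    by_cases hj : j.Coprime k
    · obtain ⟨Q, hQ⟩ := hdvd
      rw [hQ, map_mul, aeval_def, eval₂_eq_eval_map, map_cyclotomic,
        ((hξ.pow_of_coprime j hj).isRoot_cyclotomic (Nat.pos_of_ne_zero hk)).eq_zero, zero_mul]
    · rw [heval, ← h₂ j hj]
      simp only [← pow_mul, mul_comm j]
  have hPc : P.map (algebraMap ℤ ℂ) = 0 := by
    refine eq_zero_of_natDegree_lt_card_of_eval_eq_zero (P.map (algebraMap ℤ ℂ))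
      (f := fun j : Fin k => ξ ^ (j : ℕ)) ?_ ?_ ?_
    · intro a b hab
      exact Fin.ext (hξ.pow_inj a.2 b.2 hab)
    · intro j
      rw [eval_map_algebraMap, hzero]
    · rw [Fintype.card_fin]
      refine natDegree_map_le.trans_lt (lt_of_le_of_lt
        (natDegree_sum_le_of_forall_le (n := k - 1) _ _ fun i hi => ?_) (Nat.sub_one_lt hk))
      exact (natDegree_C_mul_X_pow_le _ _).trans (Nat.le_sub_one_of_lt (Finset.mem_range.1 hi))
  have hP0 : P = 0 := (Polynomial.map_eq_zero_iff (RingHom.injective_int _)).1 hPc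
  intro i hi
  have : P.coeff i = f i := by
    simp [hP, coeff_X_pow, hi]
  rw [← this, hP0, coeff_zero]

/-- The divisor representing a superelliptic divisor is unique. -/
theorem Represents.unique (hk : k ≠ 0) (hξ : IsPrimitiveRoot ξ k) {σ : Point k S → Point k S}
    {D : RootDivisor k S ξ} {E E' : Divisor k S} (h : Represents σ D E)
    (h' : Represents σ D E') : E = E' := by
  ext z
  refine sub_eq_zero.1 (eq_zero_of_fourier_eq_zero hk hξ
    (fun i => E (σ^[i] z) - E' (σ^[i] z)) ?_ ?_ 0 (Nat.pos_of_ne_zero hk))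
  · simp only [Int.cast_sub, mul_sub, Finset.sum_sub_distrib, ← h.sum_eq, ← h'.sum_eq, sub_self]
  · intro j hj
    simp only [Int.cast_sub, sub_mul, Finset.sum_sub_distrib, h.sum_eq_zero j hj,
      h'.sum_eq_zero j hj, sub_self]

/-! ### Existence of the representative and comparison of torsion -/

variable {ζ : ℂ} (hζ : IsPrimitiveRoot ζ k)

theorem IsSuperelliptic.iterate {σ : Point k S → Point k S} {D : RootDivisor k S ξ}
    (hD : IsSuperelliptic σ D) (i : ℕ) (z : Point k S) :
    D (σ^[i] z) = rootGen ξ ^ i * D z := by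
  induction i with
  | zero => simp
  | succ i ih =>
    rw [Function.iterate_succ_apply', pow_succ', mul_assoc, ← ih]
    exact Subtype.ext (hD _)

/-- Ramification points are fixed by the shift, so $D(z)=\xi D(z)$ there. -/
theorem IsSuperelliptic.eq_zero_of_ramification (hξ : ξ ≠ 1) {D : RootDivisor k S ξ}
    (hD : IsSuperelliptic (shift hζ) D) {z : Point k S} (hz : IsRamificationPoint z) :
    D z = 0 := by
  have hσ : shift hζ z = z := Subtype.ext (Prod.ext rfl (by
    change ζ * z.1.2 = z.1.2
    rw [hz, mul_zero]))
  have h := hD z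
  rw [hσ] at h
  have : (ξ - 1) * (D z : ℂ) = 0 := by rw [sub_mul, one_mul, ← h, sub_self]
  exact Subtype.ext ((mul_eq_zero.1 this).resolve_left (sub_ne_zero.2 hξ))

/-- A superelliptic divisor is represented by its trace. -/
theorem exists_represents_trace (hk : 2 ≤ k) (hξ : IsPrimitiveRoot ξ k) :
    ∃ T : RootRing ξ →+ ℤ, ∀ D : RootDivisor k S ξ, IsSuperelliptic (shift hζ) D →
      Represents (shift hζ) D (D.mapRange T T.map_zero) := by
  obtain ⟨T, hT⟩ := exists_trace_fourier (by omega) hξ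
  refine ⟨T, fun D hD => ⟨fun z => ?_, fun j hj z => ?_, fun z hz => ?_⟩⟩
  · simpa only [Finsupp.mapRange_apply, hD.iterate] using (hT (D z)).1
  · simpa only [Finsupp.mapRange_apply, hD.iterate] using (hT (D z)).2 j hj
  · rw [Finsupp.mapRange_apply, hD.eq_zero_of_ramification hζ (hξ.ne_one (by omega)) hz,
      T.map_zero]

/-- The image of a torsion divisor under an additive map `ℤ[ξ] → ℤ` is of torsion. -/
theorem RootDivisor.IsTorsion.mapRange (hk : k ≠ 0) (hξ : IsPrimitiveRoot ξ k)
    {D : RootDivisor k S ξ} (hD : D.IsTorsion) (T : RootRing ξ →+ ℤ) :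
    Divisor.IsTorsion (D.mapRange T T.map_zero) := by
  obtain ⟨N, hN, l, a, E, hE, h⟩ := hD
  have halg : IsAlgebraic ℤ N := by
    have := (isIntegral_rootRing hk hξ N).isAlgebraic
    exact (isAlgebraic_algHom_iff (Subalgebra.val _) Subtype.val_injective).1 this
  -- `T` is only additive, so the multiplier `N` is first replaced by a nonzero integer multiple
  -- $r=Ns$.
  obtain ⟨r, hr, s, hs⟩ := halg.exists_nonzero_dvd (mem_nonZeroDivisors_of_ne_zero hN)
  refine ⟨r.natAbs, Int.natAbs_pos.2 hr, ?_⟩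
  have hmem : r • D.mapRange T T.map_zero ∈ principalDivisors k S := by
    have : r • D.mapRange T T.map_zero = ∑ i, T (s * a i) • E i := by
      ext z
      have hz : (r : RootRing ξ) * D z = ∑ i, ((E i z : ℤ) : RootRing ξ) * (s * a i) := by
        have h' := h z
        rw [Finsupp.smul_apply, smul_eq_mul] at h'
        have hs' : (r : RootRing ξ) = N * s := hs
        rw [hs', mul_right_comm, h', Finset.sum_mul]
        exact Finset.sum_congr rfl fun i _ => by ring
      have := congrArg T hz
      simp only [map_sum, ← zsmul_eq_mul, map_zsmul] at this
      simpa [mul_comm] using this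
    rw [this]
    exact sum_mem fun i _ => zsmul_mem (hE i) _
  have : r.natAbs • D.mapRange T T.map_zero ∈ principalDivisors k S := by
    rw [← natCast_zsmul]
    rcases Int.natAbs_eq r with h | h
    · rwa [← h]
    · rw [← neg_mem_iff, ← neg_smul, ← h]
      exact hmem
  exact this

/-- A superelliptic divisor that is represented by a torsion divisor is of torsion. -/
theorem Represents.isTorsion (hk : k ≠ 0) (hξ : IsPrimitiveRoot ξ k) {D : RootDivisor k S ξ}
    {E : Divisor k S} (h : Represents (shift hζ) D E) (hE : E.IsTorsion) : D.IsTorsion := by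
  obtain ⟨n, hn, hp⟩ := hE
  -- The factor `k` comes from the formula for $kD$, and `n` makes $nE$ principal. The exponent
  -- $(k-1)i$ writes $\xi^{-i}$ as an element of $\mathbb{Z}[\xi]$.
  refine ⟨((n * k : ℕ) : RootRing ξ), Nat.cast_ne_zero.2 (Nat.mul_ne_zero hn.ne' hk), k,
    fun i => rootGen ξ ^ ((k - 1) * (i : ℕ)), fun i => pullback hζ hk i (n • E),
    fun i => isPrincipal_pullback hζ hk i hp, fun z => Subtype.ext ?_⟩
  have hpow : ∀ i : ℕ, ξ ^ (-(i : ℤ)) = ξ ^ ((k - 1) * i) := fun i => by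
    rw [zpow_neg, zpow_natCast, pow_mul, ← inv_pow]
    congr 1
    refine (eq_inv_of_mul_eq_one_left ?_).symm
    rw [← pow_succ, Nat.sub_add_cancel (Nat.pos_of_ne_zero hk), hξ.pow_eq_one]
  have hsum := h.sum_eq z
  rw [← Fin.sum_univ_eq_sum_range
    (fun i => ξ ^ (-(i : ℤ)) * (E ((shift hζ)^[i] z) : ℂ)) k] at hsum
  simp only [Finsupp.smul_apply, smul_eq_mul, pullback, Finsupp.comapDomain_apply]
  push_cast
  rw [mul_assoc, hsum, Finset.mul_sum]
  refine Finset.sum_congr rfl fun i _ => ?_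
  rw [hpow]
  simp only [rootGen, nsmul_eq_mul]
  push_cast
  ring

end Superelliptic
end
theorem mainTheorem5 (k : ℕ) (hk : 2 ≤ k) (S : Polynomial ℂ) (hS : Squarefree S)
    (hdeg : Nat.Coprime S.natDegree k)
    (ξ ζ : ℂ) (hξ : IsPrimitiveRoot ξ k) (hζ : IsPrimitiveRoot ζ k)
    (D : Superelliptic.RootDivisor k S ξ)
    (hD : Superelliptic.IsSuperelliptic (Superelliptic.shift hζ) D) :
    (∃! E : Superelliptic.Divisor k S,
      Superelliptic.Represents (Superelliptic.shift hζ) D E) ∧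
    ∀ E : Superelliptic.Divisor k S,
      Superelliptic.Represents (Superelliptic.shift hζ) D E →
        (Superelliptic.RootDivisor.IsTorsion D ↔ Superelliptic.Divisor.IsTorsion E) := by
  have hk0 : k ≠ 0 := by omega
  obtain ⟨T, hT⟩ := Superelliptic.exists_represents_trace (S := S) hζ hk hξ
  refine ⟨⟨_, hT D hD, fun E hE => hE.unique hk0 hξ (hT D hD)⟩, fun E hE => ⟨fun h => ?_,
    fun h => hE.isTorsion hζ hk0 hξ h⟩⟩
  -- By uniqueness any representative is the trace divisor, to which additivity of `T` applies.
  rw [hE.unique hk0 hξ (hT D hD)]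
  exact h.mapRange hk0 hξ T
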